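/- Let $K_n^r$ be the complete $r$-uniform hypergraph on $n$ vertices ($1\le r\le n$), whose edges are all the $r$-element subsets of the vertex set, and let $1\le k\le\binom nr$. For a $k$-edge coloring $c:E(K_n^r)\to\{1,\dots,k\}$ let $f(K_n^r,c)$ be the minimum, over the $k$ colors, of the number of components of the subhypergraph induced by the edges of that color, where isolated vertices are not counted as components (so an unused color has $0$ components). Let $f(n,k,r)$ be the maximum of $f(K_n^r,c)$ over all $k$-edge colorings $c$, and write $f(n,k)=f(n,k,2)$. Then: 1. $f(n,n-1)=\lfloor n/2\rfloor$ for all $n\ge 2$. 2. $f(n,n)=\lfloor (n-1)/2\rfloor$ for all $n\ge 3$. 3. If $n\ge 2$, $k\ge n-1$ and $k$ divides $\binom n2$, then $f(n,k)=\dfrac{n(n-1)}{2k}$. 4. If $n,r,t\ge 1$, $rt$ divides $n$ and $k=t\binom{n-1}{r-1}=\dfrac{t\,(n-1)!}{(r-1)!\,(n-r)!}$, then $f(n,k,r)=\dfrac{n}{rt}$. 5. If $1\le r\le n$ and $\binom nr-\binom{n-r}r\le k\le\binom nr$, then $f(n,k,r)=\left\lfloor\binom nr/k\right\rfloor$. 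-/

import Mathlib

namespace Hypergraph

/-- The number of components of a hypergraph, isolated vertices not being counted: the number of
classes of the equivalence relation on the non-isolated vertices that is generated by
"`x` and `y` lie in a common edge". -/
noncomputable def numComponents {V : Type*} (H : Hypergraph V) : ℕ :=
  Nat.card (Quot fun x y : {v : V // ¬ H.IsIsolated v} => H.Adj x y)

/-- The subhypergraph of `H` induced by the edges of color `i` in the edge coloring `c`.
(It keeps all the vertices of `H`; those in no edge of color `i` are isolated in it.) -/
def colorClass {V : Type*} {k : ℕ} (H : Hypergraph V) (c : H.edgeSet → Fin k) (i : Fin k) :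
    Hypergraph V where
  vertexSet := H.vertexSet
  edgeSet := {e | ∃ h : e ∈ H.edgeSet, c ⟨e, h⟩ = i}
  subset_vertexSet_of_mem_edgeSet' := fun _ he => H.subset_vertexSet_of_mem_edgeSet' he.1

/-- `f(H, c)`: the least number of components of a color class of the `k`-edge coloring `c`.
A color that is not used has an empty class, with `0` components. -/
noncomputable def minComponents {V : Type*} {k : ℕ} (H : Hypergraph V)
    (c : H.edgeSet → Fin k) : ℕ :=
  ⨅ i : Fin k, (H.colorClass c i).numComponents

/-- `f_k(H)`: the maximum of `f(H, c)` over all `k`-edge colorings `c` of `H`. -/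
noncomputable def maxMinComponents {V : Type*} (H : Hypergraph V) (k : ℕ) : ℕ :=
  ⨆ c : H.edgeSet → Fin k, H.minComponents c

/-- `K_n^r`, the complete `r`-uniform hypergraph on `n` vertices. -/
def completeUniform (n r : ℕ) : Hypergraph (Fin n) where
  vertexSet := Set.univ
  edgeSet := {e | e.ncard = r}
  subset_vertexSet_of_mem_edgeSet' := fun _ _ => Set.subset_univ _

end Hypergraph

/-- `f(n, k, r) = f_k(K_n^r)`; the graph case `f(n, k)` is `f n k 2`. -/
noncomputable def f (n k r : ℕ) : ℕ :=
  (Hypergraph.completeUniform n r).maxMinComponents k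

open Finset

/-! A color class has at most as many components as edges, so averaging over the colors gives
f(n,k,r) ≤ ⌊C(n,r)/k⌋ (`f_le`). Equality holds as soon as some coloring makes every class a matching
of at least that size. Baranyai's method (`exists_matching_coloring`) realizes any class sizes that
are at most n/r and add up to C(n,r): vertices are revealed one at a time, each edge being known
only by its trace on the revealed set, and Hall's theorem rounds a fractional assignment of the new
vertex to an integral one.

Equitable classes are small enough whenever C(n,r) ≤ k⌊n/r⌋ (`f_eq_choose_div`). Every claim reduces
to this inequality except f(n,n-1) for odd n = 2m+1: there 2m matchings hold at most 2m² < C(n,2)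
edges, and `le_f_two_mul_add_one` gives an explicit coloring whose classes need not be matchings but
still have at least m components. -/

/-! ### Rounding fractional weightings by Hall's theorem. -/

/-- A nonnegative weighting of `E` with row sums `1` along `c` and integral column sums `m` along
`B` can be replaced by a section of `c`, supported where the weight is positive, with the same
column sums. -/
theorem exists_section_of_weight {E ι τ : Type*} [Fintype E] [Fintype ι] [Fintype τ]
    [DecidableEq ι] [DecidableEq τ] (c : E → ι) (B : E → τ) (w : E → ℚ) (m : τ → ℕ)
    (hw : ∀ e, 0 ≤ w e) (hc : ∀ i, ∑ e with c e = i, w e = 1)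
    (hB : ∀ S, ∑ e with B e = S, w e = m S) :
    ∃ g : ι → E, (∀ i, c (g i) = i) ∧ (∀ i, 0 < w (g i)) ∧
      ∀ S, #{i | B (g i) = S} = m S := by
  classical
  -- Column `S` is split into `m S` slots; a row may use every slot of a column in which it has
  -- positive weight.
  let N : ι → Finset (Σ S, Fin (m S)) := fun i => {s | ∃ e, c e = i ∧ 0 < w e ∧ B e = s.1}
  have hcard : Fintype.card ι = Fintype.card (Σ S, Fin (m S)) := by
    have h1 : ∑ i : ι, ∑ e with c e = i, w e = ∑ S : τ, ∑ e with B e = S, w e := by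
      rw [Finset.sum_fiberwise, Finset.sum_fiberwise]
    simp only [hc, hB] at h1
    simp only [sum_const, card_univ, nsmul_eq_mul, mul_one] at h1
    rw [Fintype.card_sigma]
    simp only [Fintype.card_fin]
    exact_mod_cast h1
  have hall : ∀ A : Finset ι, #A ≤ #(A.biUnion N) := by
    intro A
    let T : Finset τ := {S | ∃ e, c e ∈ A ∧ 0 < w e ∧ B e = S}
    have hT : A.biUnion N = T.sigma fun S => (univ : Finset (Fin (m S))) := by
      ext s
      simp only [mem_biUnion, N, mem_filter, mem_univ, true_and, mem_sigma, and_true, T]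
      constructor
      · rintro ⟨i, hi, e, rfl, h⟩
        exact ⟨e, hi, h⟩
      · rintro ⟨e, he, h⟩
        exact ⟨_, he, e, rfl, h⟩
    rw [hT, card_sigma]
    simp only [card_univ, Fintype.card_fin]
    have h1 : (#A : ℚ) = ∑ e with c e ∈ A, w e := by
      rw [← Finset.sum_fiberwise_eq_sum_filter]
      simp [hc]
    have h2 : ((∑ S ∈ T, m S : ℕ) : ℚ) = ∑ e with B e ∈ T, w e := by
      rw [← Finset.sum_fiberwise_eq_sum_filter]
      simp [hB]
    -- Hall's condition: all the weight of the rows in `A` lies in the columns of `T`.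
    have h3 : ∑ e with c e ∈ A, w e ≤ ∑ e with B e ∈ T, w e := by
      rw [Finset.sum_filter, Finset.sum_filter]
      refine Finset.sum_le_sum fun e _ => ?_
      rcases (hw e).eq_or_lt with h | h
      · simp [← h]
      · by_cases he : c e ∈ A
        · have : B e ∈ T := by
            simp only [T, mem_filter, mem_univ, true_and]
            exact ⟨e, he, h, rfl⟩
          simp [he, this]
        · rw [if_neg he]
          split_ifs
          · exact h.le
          · exact le_rfl
    rw [← h1, ← h2] at h3
    exact_mod_cast h3
  obtain ⟨h, hinj, hN⟩ := (Finset.all_card_le_biUnion_card_iff_exists_injective N).1 hall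
  have hbij : Function.Bijective h := (Fintype.bijective_iff_injective_and_card h).2 ⟨hinj, hcard⟩
  have : ∀ i, ∃ e, c e = i ∧ 0 < w e ∧ B e = (h i).1 := by
    intro i
    simpa [N] using hN i
  choose g hg1 hg2 hg3 using this
  refine ⟨g, hg1, hg2, fun S => ?_⟩
  have h4 : #{i | B (g i) = S} = #(({S} : Finset τ).sigma fun S => (univ : Finset (Fin (m S)))) := by
    refine Finset.card_bij (fun i _ => h i) ?_ (fun _ _ _ _ hh => hinj hh) ?_
    · intro i hi
      simp only [mem_filter, mem_univ, true_and] at hi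
      simp [← hg3, hi]
    · intro s hs
      obtain ⟨i, rfl⟩ := hbij.2 s
      refine ⟨i, ?_, rfl⟩
      simpa [hg3] using hs
  rw [h4, card_sigma]
  simp

/-- Integral rounding: a nonnegative weighting of `E` with row sums at most `1` along `c` and
integral column sums `m` along `B` can be replaced by a subset of its support that has the same
column sums, meets every row at most once, and meets every row of sum `1`. -/
theorem exists_partial_section_of_weight {E ι τ : Type*} [Fintype E] [Fintype ι] [Fintype τ]
    [DecidableEq E] [DecidableEq ι] [DecidableEq τ] (c : E → ι) (B : E → τ) (w : E → ℚ)
    (m : τ → ℕ) (hw : ∀ e, 0 ≤ w e) (hc : ∀ i, ∑ e with c e = i, w e ≤ 1)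
    (hB : ∀ S, ∑ e with B e = S, w e = m S) :
    ∃ X : Finset E, (∀ e ∈ X, ∀ e' ∈ X, c e = c e' → e = e') ∧ (∀ e ∈ X, 0 < w e) ∧
      (∀ i, ∑ e with c e = i, w e = 1 → ∃ e ∈ X, c e = i) ∧
      ∀ S, #{e ∈ X | B e = S} = m S := by
  have htot : ∑ i : ι, ∑ e with c e = i, w e = ∑ S : τ, (m S : ℚ) := by
    simp only [← hB]
    rw [Finset.sum_fiberwise, Finset.sum_fiberwise]
  have hle : ∑ S, m S ≤ Fintype.card ι := by
    have : ∑ i : ι, ∑ e with c e = i, w e ≤ ∑ i : ι, (1 : ℚ) := Finset.sum_le_sum fun i _ => hc i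
    rw [htot] at this
    simp only [sum_const, card_univ, nsmul_eq_mul, mul_one] at this
    exact_mod_cast this
  obtain ⟨d, hd⟩ := Nat.exists_eq_add_of_le hle
  have hd' : (Fintype.card ι : ℚ) = ∑ S, (m S : ℚ) + d := by exact_mod_cast hd
  -- Each row gets a slack entry bringing its sum to 1. All slack goes into one extra column, whose
  -- sum `d` is an integer. A row of sum 1 has zero slack, so its chosen entry is genuine.
  obtain ⟨g, hg1, hg2, hg3⟩ := exists_section_of_weight (E := E ⊕ ι) (τ := Option τ)
    (Sum.elim c id) (Sum.elim (fun e => some (B e)) (fun _ => none))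
    (Sum.elim w fun i => 1 - ∑ e with c e = i, w e) (fun o => o.elim d m)
    (by
      rintro (e | i)
      · exact hw e
      · simpa using hc i)
    (by
      intro i
      rw [Finset.sum_filter, Fintype.sum_sum_type]
      change (∑ e, if c e = i then w e else 0) +
        ∑ j, (if j = i then 1 - ∑ e with c e = j, w e else 0) = 1
      rw [← Finset.sum_filter, Finset.sum_ite_eq']
      simp)
    (by
      rintro (_ | S)
      · rw [Finset.sum_filter, Fintype.sum_sum_type]
        simp [htot, hd']
      · rw [Finset.sum_filter, Fintype.sum_sum_type]
        simp [← Finset.sum_filter, hB])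
  refine ⟨univ.filter fun e => g (c e) = Sum.inl e, ?_, ?_, ?_, ?_⟩
  · intro e he e' he' h
    simp only [mem_filter, mem_univ, true_and] at he he'
    rw [h, he'] at he
    exact (Sum.inl.inj he).symm
  · intro e he
    simp only [mem_filter, mem_univ, true_and] at he
    simpa [he] using hg2 (c e)
  · intro i hi
    rcases h : g i with e | j
    · have h1 := hg1 i
      rw [h] at h1
      simp only [Sum.elim_inl] at h1
      exact ⟨e, by simp [h1, h], h1⟩
    · have h1 := hg1 i
      have h2 := hg2 i
      rw [h] at h1 h2
      simp only [Sum.elim_inr, id] at h1 h2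
      rw [h1, hi] at h2
      simp at h2
  · intro S
    rw [← show #{i | Sum.elim (fun e => some (B e)) (fun _ => none) (g i) = some S} = m S from
      hg3 (some S)]
    refine Finset.card_bij (fun e _ => c e) ?_ ?_ ?_
    · intro e he
      simp only [mem_filter, mem_univ, true_and] at he
      simp [he.1, he.2]
    · intro e he e' he' h
      simp only [mem_filter, mem_univ, true_and] at he he'
      have := he.1
      rw [h, he'.1] at this
      exact (Sum.inl.inj this).symm
    · intro i hi
      simp only [mem_filter, mem_univ, true_and] at hi
      rcases h : g i with e | j
      · have h1 := hg1 i
        rw [h] at h1 hi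
        simp only [Sum.elim_inl, Option.some.injEq] at h1 hi
        exact ⟨e, by simp [h1, h, hi], h1⟩
      · rw [h] at hi
        simp at hi

/-! ### Baranyai's theorem. -/

/-- The induction behind Baranyai's theorem: the prescribed edges, restricted to a set `L` of
vertices. -/
theorem exists_partial_matching_coloring {V E ι : Type*} [Fintype V] [Fintype E] [Fintype ι]
    [DecidableEq V] [DecidableEq E] [DecidableEq ι] (r : ℕ) (c : E → ι)
    (hE : Fintype.card E = (Fintype.card V).choose r)
    (hc : ∀ i, r * #{e | c e = i} ≤ Fintype.card V) (L : Finset V) :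
    ∃ B : E → Finset V, (∀ e, B e ⊆ L) ∧ (∀ e, #(B e) ≤ r) ∧
      (∀ e e', e ≠ e' → c e = c e' → Disjoint (B e) (B e')) ∧
      (∀ S ⊆ L, #S ≤ r → #{e | B e = S} = (#Lᶜ).choose (r - #S)) ∧
      ∀ i, r * #{e | c e = i} ≤ #Lᶜ + ∑ e with c e = i, #(B e) := by
  -- The last invariant says that the incidences a class still lacks are no more numerous than the
  -- unrevealed vertices.
  induction L using Finset.induction_on with
  | empty =>
    refine ⟨fun _ => ∅, by simp, by simp, by simp, ?_, by simpa using hc⟩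
    intro S hS _
    obtain rfl := Finset.subset_empty.1 hS
    simp [hE]
  | insert v L hv ih =>
    obtain ⟨B, hBL, hBr, hdisj, hcount, hcov⟩ := ih
    have hcompl : #Lᶜ = #(insert v L)ᶜ + 1 := by
      have : Lᶜ = insert v (insert v L)ᶜ := by
        ext x
        simp only [mem_compl, mem_insert]
        grind
      rw [this, card_insert_of_notMem (by simp)]
    set p := #(insert v L)ᶜ with hp
    have hp0 : (0 : ℚ) < (p : ℚ) + 1 := by positivity
    -- The number of `r`-sets with trace `insert v S` on `insert v L`. The guard `#S < r` matters:
    -- truncated subtraction would otherwise give `p.choose 0 = 1`.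
    let m : Finset V → ℕ := fun S => if S ⊆ L ∧ #S < r then p.choose (r - #S - 1) else 0
    obtain ⟨X, hX1, hXpos, hX2, hX3⟩ := exists_partial_section_of_weight c B
      -- The edge still needs `r - #(B e)` of the `p + 1` unrevealed vertices; this is the chance
      -- that `v` is among them.
      (fun e => ((r : ℚ) - #(B e)) / (p + 1)) m
      (by
        intro e
        have : (#(B e) : ℚ) ≤ r := by exact_mod_cast hBr e
        exact div_nonneg (by linarith) hp0.le)
      (by
        intro i
        rw [← Finset.sum_div, div_le_one hp0, Finset.sum_sub_distrib]
        have h := hcov i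
        rw [hcompl] at h
        have h' : (r : ℚ) * #{e | c e = i} ≤ p + 1 + ∑ e with c e = i, (#(B e) : ℚ) := by
          exact_mod_cast h
        simp only [sum_const, nsmul_eq_mul]
        linarith)
      (by
        intro S
        rw [Finset.sum_congr rfl (g := fun _ => ((r : ℚ) - #S) / (p + 1))
          (by intro e he; simp only [mem_filter] at he; rw [he.2])]
        rw [sum_const, nsmul_eq_mul]
        by_cases hSL : S ⊆ L
        · rcases lt_trichotomy #S r with h | h | h
          · rw [hcount S hSL h.le, hcompl]
            simp only [m, hSL, h, and_self, if_true]
            obtain ⟨j, hj⟩ : ∃ j, r = #S + (j + 1) := ⟨r - #S - 1, by omega⟩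
            have e1 : r - #S = j + 1 := by omega
            have e2 : (r : ℚ) - #S = j + 1 := by rw [hj]; push_cast; ring
            rw [e1, e2, Nat.add_sub_cancel]
            have := Nat.add_one_mul_choose_eq p j
            have h' : ((p : ℚ) + 1) * p.choose j = (p + 1).choose (j + 1) * (j + 1) := by
              exact_mod_cast this
            field_simp
            linarith
          · simp [m, h]
          · have : #{e | B e = S} = 0 := by
              rw [card_eq_zero, filter_eq_empty_iff]
              rintro e _ rfl
              exact absurd (hBr e) (by omega)
            simp [m, this, h.le]
        · have : #{e | B e = S} = 0 := by
            rw [card_eq_zero, filter_eq_empty_iff]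
            rintro e _ rfl
            exact hSL (hBL e)
          simp [m, this, hSL])
    have hvB : ∀ e, v ∉ B e := fun e h => hv (hBL e h)
    have hXr : ∀ e ∈ X, #(B e) < r := by
      intro e he
      have := hXpos e he
      rw [div_pos_iff_of_pos_right hp0] at this
      have : (#(B e) : ℚ) < r := by linarith
      exact_mod_cast this
    refine ⟨fun e => if e ∈ X then insert v (B e) else B e, ?_, ?_, ?_, ?_, ?_⟩
    · intro e
      dsimp only
      split_ifs
      · exact insert_subset_insert _ (hBL e)
      · exact (hBL e).trans (subset_insert _ _)
    · intro e
      dsimp only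
      split_ifs with h
      · rw [card_insert_of_notMem (hvB e)]
        exact hXr e h
      · exact hBr e
    · intro e e' hne hcc
      have := hdisj e e' hne hcc
      dsimp only
      split_ifs with h h' h'
      · exact absurd (hX1 e h e' h' hcc) hne
      · simp [this, hvB]
      · simp [this, hvB]
      · exact this
    · intro S hS hSr
      by_cases hvS : v ∈ S
      · have hS' : S.erase v ⊆ L := by
          intro x hx
          rw [mem_erase] at hx
          exact (mem_insert.1 (hS hx.2)).resolve_left hx.1
        have hcS : #(S.erase v) + 1 = #S := card_erase_add_one hvS
        have h1 : (univ.filter fun e => (if e ∈ X then insert v (B e) else B e) = S) =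
            {e ∈ X | B e = S.erase v} := by
          ext e
          simp only [mem_filter, mem_univ, true_and]
          split_ifs with h
          · constructor
            · rintro rfl
              exact ⟨h, (erase_insert (hvB e)).symm⟩
            · rintro ⟨_, h'⟩
              rw [h', insert_erase hvS]
          · simp only [h, false_and, iff_false]
            rintro rfl
            exact hvB e hvS
        rw [h1, hX3]
        simp only [m]
        rw [if_pos ⟨hS', by omega⟩]
        congr 1
        omega
      · have hS' : S ⊆ L := (subset_insert_iff_of_notMem hvS).1 hS
        have h1 : (univ.filter fun e => B e = S) =
            (univ.filter fun e => (if e ∈ X then insert v (B e) else B e) = S) ∪ {e ∈ X | B e = S} := by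
          ext e
          simp only [mem_filter, mem_univ, true_and, mem_union]
          split_ifs with h
          · simp only [h, true_and]
            constructor
            · exact Or.inr
            · rintro (rfl | h')
              · simp at hvS
              · exact h'
          · simp [h]
        have h2 : Disjoint (univ.filter fun e => (if e ∈ X then insert v (B e) else B e) = S)
            {e ∈ X | B e = S} := by
          rw [Finset.disjoint_left]
          intro e he he'
          simp only [mem_filter, mem_univ, true_and] at he he'
          rw [if_pos he'.1] at he
          subst he
          simp at hvS
        have h3 := hcount S hS' hSr
        rw [h1, card_union_of_disjoint h2, hX3, hcompl] at h3
        simp only [m, hS', true_and] at h3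
        split_ifs at h3 with h
        · obtain ⟨j, hj⟩ : ∃ j, r - #S = j + 1 := ⟨r - #S - 1, by omega⟩
          rw [hj, Nat.choose_succ_succ, Nat.add_sub_cancel] at h3
          rw [hj]
          simp only [Nat.succ_eq_add_one] at h3
          dsimp only
          omega
        · have : r - #S = 0 := by omega
          rw [this] at h3 ⊢
          simpa using h3
    · intro i
      have h := hcov i
      rw [hcompl] at h
      have hle : ∀ e, #(B e) ≤ #(if e ∈ X then insert v (B e) else B e) := by
        intro e
        split_ifs
        · exact card_le_card (subset_insert _ _)
        · exact le_rfl
      have hsum : ∑ e with c e = i, #(B e) ≤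
          ∑ e with c e = i, #(if e ∈ X then insert v (B e) else B e) :=
        Finset.sum_le_sum fun e _ => hle e
      -- Revealing `v` lowers the right side by one. Slack absorbs this; in the tight case the row
      -- sum is 1, so some edge of the class receives `v`.
      rcases h.lt_or_eq with h' | h'
      · dsimp only
        omega
      · obtain ⟨e₀, he₀, hc₀⟩ := hX2 i (by
          rw [← Finset.sum_div, div_eq_one_iff_eq hp0.ne', Finset.sum_sub_distrib]
          have h'' : (r : ℚ) * #{e | c e = i} = p + 1 + ∑ e with c e = i, (#(B e) : ℚ) := by
            exact_mod_cast h'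
          simp only [sum_const, nsmul_eq_mul]
          linarith)
        have hlt : ∑ e with c e = i, #(B e) <
            ∑ e with c e = i, #(if e ∈ X then insert v (B e) else B e) := by
          refine Finset.sum_lt_sum (fun e _ => hle e) ⟨e₀, by simp [hc₀], ?_⟩
          rw [if_pos he₀, card_insert_of_notMem (hvB e₀)]
          exact Nat.lt_succ_self _
        dsimp only
        omega

/-- **Baranyai's theorem** for matchings: if `c` splits `E` into classes of size at most `|V| / r`,
and `E` is as large as the set of `r`-subsets of `V`, then `E` can be identified with that set in
such a way that each class becomes a matching. -/
theorem exists_matching_coloring {V E ι : Type*} [Fintype V] [Fintype E] [Fintype ι]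
    [DecidableEq V] [DecidableEq E] [DecidableEq ι] (r : ℕ) (c : E → ι)
    (hE : Fintype.card E = (Fintype.card V).choose r)
    (hc : ∀ i, r * #{e | c e = i} ≤ Fintype.card V) :
    ∃ B : E → Finset V, Function.Injective B ∧ (∀ S, #S = r ↔ ∃ e, B e = S) ∧
      ∀ e e', e ≠ e' → c e = c e' → Disjoint (B e) (B e') := by
  obtain ⟨B, -, hr, hd, hcount, -⟩ := exists_partial_matching_coloring r c hE hc univ
  have hr' : ∀ e, #(B e) = r := by
    intro e
    by_contra h
    have hlt : #(B e) < r := lt_of_le_of_ne (hr e) h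
    have h1 := hcount (B e) (subset_univ _) (hr e)
    obtain ⟨j, hj⟩ : ∃ j, r - #(B e) = j + 1 := ⟨r - #(B e) - 1, by omega⟩
    rw [hj] at h1
    simp only [compl_univ, card_empty, Nat.choose_zero_succ, card_eq_zero,
      filter_eq_empty_iff] at h1
    exact h1 (mem_univ e) rfl
  have h1 : ∀ S, #S = r → #{e | B e = S} = 1 := by
    intro S hS
    rw [hcount S (subset_univ _) hS.le, hS]
    simp
  refine ⟨B, ?_, ?_, hd⟩
  · intro e e' h
    exact card_le_one.1 (h1 _ (hr' e')).le e (by simp [h]) e' (by simp)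
  · intro S
    constructor
    · intro hS
      obtain ⟨e, he⟩ := card_pos.1 (by rw [h1 S hS]; exact one_pos)
      exact ⟨e, by simpa using he⟩
    · rintro ⟨e, rfl⟩
      exact hr' e

/-! ### Counting components and the averaging bound. -/

namespace Hypergraph

/-- If the map `φ` is constant on the edges of `H`, then `H` has at least as many components as
`φ` has values on the non-isolated vertices. -/
theorem card_le_numComponents {V α : Type*} [Finite V] {H : Hypergraph V} (φ : V → α)
    (hφ : ∀ x y, H.Adj x y → φ x = φ y) (T : Finset α)
    (hT : ∀ a ∈ T, ∃ x, ¬ H.IsIsolated x ∧ φ x = a) : #T ≤ H.numComponents := by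
  choose x hx hxa using hT
  rw [← Nat.card_eq_finsetCard, numComponents]
  refine Nat.card_le_card_of_injective (fun a : T => Quot.mk _ ⟨x a a.2, hx a a.2⟩) ?_
  intro a b hab
  have h : φ (x a a.2) = φ (x b b.2) := congrArg
    (Quot.lift (fun v : {v : V // ¬ H.IsIsolated v} => φ v) fun u v huv => hφ u v huv) hab
  rw [hxa, hxa] at h
  exact Subtype.ext h

/-- A hypergraph has at most as many components as edges. -/
theorem numComponents_le_card_edgeSet {V : Type*} [Finite V] (H : Hypergraph V) :
    H.numComponents ≤ Nat.card H.edgeSet := by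
  have h : ∀ v : {v : V // ¬ H.IsIsolated v}, ∃ e : H.edgeSet, (v : V) ∈ (e : Set V) := by
    rintro ⟨v, hv⟩
    simp only [IsIsolated, not_forall, not_not] at hv
    obtain ⟨e, he, hve⟩ := hv
    exact ⟨⟨e, he⟩, hve⟩
  choose g hg using h
  refine Nat.card_le_card_of_injective (fun q => g q.out) ?_
  intro p q hpq
  rw [← Quot.out_eq p, ← Quot.out_eq q]
  refine Quot.sound ⟨g p.out, (g p.out).2, hg _, ?_⟩
  have := hg q.out
  dsimp only at hpq
  rwa [← hpq] at this

theorem card_edgeSet_colorClass {V : Type*} {k : ℕ} (H : Hypergraph V) (c : H.edgeSet → Fin k)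
    (i : Fin k) : Nat.card (H.colorClass c i).edgeSet = Nat.card {e // c e = i} := by
  refine Nat.card_congr ⟨fun e => ⟨⟨e, e.2.1⟩, e.2.2⟩, fun e => ⟨e.1, e.1.2, e.2⟩, ?_, ?_⟩
  · intro e
    rfl
  · intro e
    rfl

theorem mul_minComponents_le {V : Type*} [Finite V] {k : ℕ} (H : Hypergraph V)
    (c : H.edgeSet → Fin k) : k * H.minComponents c ≤ Nat.card H.edgeSet := by
  calc k * H.minComponents c = ∑ _i : Fin k, H.minComponents c := by simp
    _ ≤ ∑ i : Fin k, Nat.card {e // c e = i} := by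
      refine Finset.sum_le_sum fun i _ => ?_
      rw [← card_edgeSet_colorClass]
      exact (ciInf_le (OrderBot.bddBelow _) i).trans (numComponents_le_card_edgeSet _)
    _ = Nat.card (Σ i : Fin k, {e // c e = i}) := Nat.card_sigma.symm
    _ = Nat.card H.edgeSet := Nat.card_congr (Equiv.sigmaFiberEquiv c)

theorem maxMinComponents_le {V : Type*} [Finite V] (H : Hypergraph V) {k : ℕ} (hk : 0 < k) :
    H.maxMinComponents k ≤ Nat.card H.edgeSet / k := by
  have : Nonempty (Fin k) := ⟨⟨0, hk⟩⟩
  refine ciSup_le fun c => ?_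
  rw [Nat.le_div_iff_mul_le hk, mul_comm]
  exact mul_minComponents_le H c

theorem le_maxMinComponents {V : Type*} [Finite V] (H : Hypergraph V) {k m : ℕ} (hk : 0 < k)
    (c : H.edgeSet → Fin k) (h : ∀ i, m ≤ (H.colorClass c i).numComponents) :
    m ≤ H.maxMinComponents k := by
  have : Nonempty (Fin k) := ⟨⟨0, hk⟩⟩
  exact (le_ciInf h).trans (le_ciSup (f := fun c => H.minComponents c)
    (Set.finite_range _).bddAbove c)

theorem card_edgeSet_completeUniform (n r : ℕ) :
    Nat.card (completeUniform n r).edgeSet = n.choose r := by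
  have h : (completeUniform n r).edgeSet =
      (fun s : Finset (Fin n) => (s : Set (Fin n))) '' ((powersetCard r univ : Finset (Finset (Fin n))) : Set _) := by
    ext e
    constructor
    · intro he
      refine ⟨e.toFinite.toFinset, ?_, by simp⟩
      rw [mem_coe, mem_powersetCard_univ]
      rw [← Set.ncard_eq_toFinset_card e]
      exact he
    · rintro ⟨s, hs, rfl⟩
      have hs' : #s = r := by simpa using hs
      exact (Set.ncard_coe_finset s).trans hs'
  rw [Nat.card_coe_set_eq, h, Set.ncard_image_of_injective _ Finset.coe_injective,
    Set.ncard_coe_finset, card_powersetCard, card_univ, Fintype.card_fin]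

end Hypergraph

/-! ### Equitable colorings by matchings. -/

open Hypergraph

theorem f_le {n k : ℕ} (r : ℕ) (hk : 0 < k) : f n k r ≤ n.choose r / k := by
  rw [f, ← card_edgeSet_completeUniform n r]
  exact maxMinComponents_le _ hk

theorem card_fin_mod_eq {N k : ℕ} (i : Fin k) (hk : 0 < k) :
    #{e : Fin N | (⟨e % k, Nat.mod_lt _ hk⟩ : Fin k) = i} =
      N / k + if (i : ℕ) < N % k then 1 else 0 := by
  have h := Nat.count_modEq_card N hk i
  rw [Nat.mod_eq_of_lt i.2, Nat.count_eq_card_filter_range] at h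
  rw [← h]
  refine Finset.card_bij (fun e _ => (e : ℕ)) ?_ (fun _ _ _ _ h => Fin.ext h) ?_
  · intro e he
    simp only [mem_filter, mem_univ, true_and, Fin.ext_iff] at he
    simp [Nat.ModEq, he, Nat.mod_eq_of_lt i.2]
  · intro e he
    simp only [mem_filter, mem_range, Nat.ModEq, Nat.mod_eq_of_lt i.2] at he
    exact ⟨⟨e, he.1⟩, by simp [Fin.ext_iff, he.2], rfl⟩

/-- Whenever the `r`-subsets are few enough for an equitable coloring with `k` colors to consist of
matchings, such a coloring exists, and it is optimal. -/
theorem f_eq_choose_div {n k r : ℕ} (hr : 1 ≤ r) (hk : 0 < k)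
    (h : n.choose r ≤ k * (n / r)) : f n k r = n.choose r / k := by
  refine (f_le r hk).antisymm ?_
  set N := n.choose r with hN
  let col : Fin N → Fin k := fun e => ⟨e % k, Nat.mod_lt _ hk⟩
  have hcol : ∀ i, #{e | col e = i} = N / k + if (i : ℕ) < N % k then 1 else 0 :=
    fun i => card_fin_mod_eq i hk
  obtain ⟨B, hinj, hB, hd⟩ := exists_matching_coloring (V := Fin n) r col (by simp [hN]) (by
    intro i
    rw [hcol, Fintype.card_fin]
    refine (Nat.mul_le_mul_left r ?_).trans (Nat.mul_div_le n r)
    split_ifs with hi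
    -- A class larger than `N / k` occurs only if `k ∤ N`, and then `k * (N / k) < N`.
    · have h1 := Nat.div_add_mod N k
      have h2 : k * (N / k) < k * (n / r) := by omega
      exact Nat.lt_of_mul_lt_mul_left h2
    · rw [add_zero]
      exact Nat.div_le_of_le_mul h)
  have hidx : ∀ e : (completeUniform n r).edgeSet, ∃ j, (B j : Set (Fin n)) = e := by
    rintro ⟨e, he⟩
    obtain ⟨j, hj⟩ := (hB e.toFinite.toFinset).1
      ((Set.ncard_eq_toFinset_card e).symm.trans he)
    exact ⟨j, by simp [hj]⟩
  choose idx hidx using hidx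
  have hdis : ∀ j j' x, col j = col j' → x ∈ B j → x ∈ B j' → j = j' := by
    intro j j' x hc hx hx'
    by_contra hne
    exact Finset.disjoint_left.1 (hd j j' hne hc) hx hx'
  have hcard : ∀ j, #(B j) = r := fun j => (hB _).2 ⟨j, rfl⟩
  refine le_maxMinComponents _ hk (fun e => col (idx e)) fun i => ?_
  calc N / k ≤ #{j | col j = i} := by
        rw [hcol]
        exact Nat.le_add_right _ _
    _ = #(({j | col j = i} : Finset (Fin N)).map ⟨singleton, singleton_injective⟩) :=
        (card_map _).symm
    _ ≤ _ := by
      -- A vertex is labelled by the set of edges of color `i` through it; for a matching this is a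
      -- singleton or empty.
      refine card_le_numComponents
        (fun x => ({j | col j = i ∧ x ∈ B j} : Finset (Fin N))) ?_ _ ?_
      · rintro x y ⟨e, ⟨he, hei⟩, hx, hy⟩
        have hx' : x ∈ B (idx ⟨e, he⟩) := by
          rw [← mem_coe, hidx]
          exact hx
        have hy' : y ∈ B (idx ⟨e, he⟩) := by
          rw [← mem_coe, hidx]
          exact hy
        ext j
        simp only [mem_filter, mem_univ, true_and]
        constructor
        · rintro ⟨hj, hxj⟩
          rw [hdis _ _ x (hj.trans hei.symm) hxj hx']
          exact ⟨hei, hy'⟩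
        · rintro ⟨hj, hyj⟩
          rw [hdis _ _ y (hj.trans hei.symm) hyj hy']
          exact ⟨hei, hx'⟩
      · intro a ha
        simp only [mem_map, mem_filter, mem_univ, true_and, Function.Embedding.coeFn_mk] at ha
        obtain ⟨j, hj, rfl⟩ := ha
        obtain ⟨x, hx⟩ := card_pos.1 (by rw [hcard j]; exact hr)
        refine ⟨x, ?_, ?_⟩
        · intro hiso
          have hmem : (B j : Set (Fin n)) ∈ (completeUniform n r).edgeSet :=
            (Set.ncard_coe_finset _).trans (hcard j)
          have hj' : idx ⟨_, hmem⟩ = j := by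
            have h1 := hidx ⟨_, hmem⟩
            exact hinj (Finset.coe_injective h1)
          exact hiso _ ⟨hmem, (congrArg col hj').trans hj⟩ hx
        · ext j'
          simp only [mem_filter, mem_univ, true_and, mem_singleton]
          constructor
          · rintro ⟨hj', hxj'⟩
            exact hdis _ _ x (hj'.trans hj.symm) hxj' hx
          · rintro rfl
            exact ⟨hj, hx⟩

/-- Write n = s + qr with s < r. Since C(s,r) = 0, C(n,r) telescopes into q differences C(j+r,r) -
C(j,r); these are nondecreasing in j, so each is at most the last. -/
theorem choose_le_div_mul_sub {n r : ℕ} (hr : 1 ≤ r) :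
    n.choose r ≤ (n / r) * (n.choose r - (n - r).choose r) := by
  have hstep : ∀ m, (m + r).choose r + (m + 1).choose r ≤
      (m + 1 + r).choose r + m.choose r := by
    intro m
    obtain ⟨s, rfl⟩ := Nat.exists_eq_add_of_le' hr
    have h1 : (m + 1 + (s + 1)).choose (s + 1) =
        (m + (s + 1)).choose s + (m + (s + 1)).choose (s + 1) := by
      rw [show m + 1 + (s + 1) = m + (s + 1) + 1 by ring, Nat.choose_succ_succ]
    have h2 : (m + 1).choose (s + 1) = m.choose s + m.choose (s + 1) := Nat.choose_succ_succ _ _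
    have h3 : m.choose s ≤ (m + (s + 1)).choose s := Nat.choose_le_choose s (by omega)
    omega
  have hmono : Monotone fun m => ((m + r).choose r : ℤ) - m.choose r := by
    refine monotone_nat_of_le_succ fun m => ?_
    have := hstep m
    zify at this
    linarith
  have key : ∀ q s, s < r → ((s + q * r).choose r : ℤ) ≤
      q * ((s + q * r).choose r - (s + q * r - r).choose r : ℤ) := by
    intro q s hs
    induction q with
    | zero => simp [Nat.choose_eq_zero_of_lt hs]
    | succ q ih =>
      have e : s + (q + 1) * r - r = s + q * r := by
        rw [add_mul, one_mul]
        omega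
      rw [e]
      rcases Nat.eq_zero_or_pos q with rfl | hq
      · simp [Nat.choose_eq_zero_of_lt hs]
      · have hle : r ≤ q * r := Nat.le_mul_of_pos_left r hq
        have h := hmono (show s + q * r - r ≤ s + q * r by omega)
        dsimp only at h
        rw [show s + q * r - r + r = s + q * r by omega,
          show s + q * r + r = s + (q + 1) * r by ring] at h
        have h' := mul_le_mul_of_nonneg_left h (show (0 : ℤ) ≤ q by positivity)
        push_cast
        linarith
  have h := key (n / r) (n % r) (Nat.mod_lt _ hr)
  rw [mul_comm, Nat.mod_add_div] at h
  zify [Nat.choose_le_choose r (Nat.sub_le n r)]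
  exact_mod_cast h

/-! ### The explicit coloring for odd n. -/

/-- `K_n` for odd `n`, with the vertices labelled by `ℤ/n`: color the edge `ab` by `a + b` if this
is nonzero, and an edge joining `a` and `-a` by `2a` or `-2a`. -/
theorem le_f_two_mul_add_one {m : ℕ} (hm : 0 < m) : m ≤ f (2 * m + 1) (2 * m) 2 := by
  classical
  have hzero : (2 : ZMod (2 * m + 1)) * m + 1 = 0 := by
    exact_mod_cast ZMod.natCast_self (2 * m + 1)
  have htwo : ∀ w : ZMod (2 * m + 1), 2 * w = 0 → w = 0 := by
    intro w hw
    linear_combination w * hzero - m * hw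
  let σ : Fin (2 * m + 1) ≃ ZMod (2 * m + 1) := (ZMod.finEquiv (2 * m + 1)).toEquiv
  have hcardZ : Fintype.card (ZMod (2 * m + 1)) = 2 * m + 1 := ZMod.card _
  let τ : {s : ZMod (2 * m + 1) // s ≠ 0} ≃ Fin (2 * m) :=
    Fintype.equivFinOfCardEq (by rw [Fintype.card_subtype_compl]; simp)
  have hcol : ∀ e : (completeUniform (2 * m + 1) 2).edgeSet,
      ∃ (s : {s : ZMod (2 * m + 1) // s ≠ 0}) (a b : Fin (2 * m + 1)), (e : Set _) = {a, b} ∧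
        a ≠ b ∧ (σ a + σ b ≠ 0 ∧ σ a + σ b = s ∨ σ a + σ b = 0 ∧ 2 * σ a = s) := by
    rintro ⟨e, he⟩
    obtain ⟨a, b, hab, rfl⟩ := Set.ncard_eq_two.1 he
    by_cases h : σ a + σ b = 0
    · refine ⟨⟨2 * σ a, fun h0 => hab (σ.injective ?_)⟩, a, b, rfl, hab, Or.inr ⟨h, rfl⟩⟩
      linear_combination h0 - h
    · exact ⟨⟨_, h⟩, a, b, rfl, hab, Or.inl ⟨h, rfl⟩⟩
  choose col a b hab hne hcol using hcol
  refine le_maxMinComponents _ (by omega) (fun e => τ (col e)) fun i => ?_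
  obtain ⟨⟨s, hs⟩, rfl⟩ := τ.surjective i
  -- The edges of sum `s`: they match all vertices except s/2.
  let T : Finset (Sym2 (ZMod (2 * m + 1))) :=
    ({u | 2 * u ≠ s} : Finset (ZMod (2 * m + 1))).image fun u => s(u, s - u)
  have hT : m ≤ #T := by
    have h1 : #({u | 2 * u = s} : Finset (ZMod (2 * m + 1))) ≤ 1 := by
      refine card_le_one.2 fun u hu v hv => ?_
      simp only [mem_filter, mem_univ, true_and] at hu hv
      exact sub_eq_zero.1 (htwo _ (by linear_combination hu - hv))
    have h2 := card_filter_add_card_filter_not (s := (univ : Finset (ZMod (2 * m + 1))))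
      (fun u => 2 * u = s)
    rw [card_univ, hcardZ] at h2
    have h3 : #({u | 2 * u ≠ s} : Finset (ZMod (2 * m + 1))) ≤ 2 * #T := by
      refine card_le_mul_card_image _ 2 ?_
      intro p hp
      obtain ⟨u, -, rfl⟩ := mem_image.1 hp
      refine (card_le_card (t := {u, s - u}) ?_).trans card_le_two
      intro v hv
      simp only [mem_filter, Sym2.eq_iff] at hv
      simp only [mem_insert, mem_singleton]
      tauto
    simp only [ne_eq] at h3
    omega
  -- The only other edge the class can have joins s/2 to -s/2. Giving s/2 the label of the pair
  -- containing -s/2 keeps labels constant on edges, so no two pairs merge.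
  refine hT.trans (card_le_numComponents
    (fun x => if 2 * σ x = s then s(-σ x, s + σ x) else s(σ x, s - σ x)) ?_ T ?_)
  · rintro x y ⟨e, ⟨he, hei⟩, hx, hy⟩
    have hc : col ⟨e, he⟩ = ⟨s, hs⟩ := τ.injective hei
    have hn := hne ⟨e, he⟩
    have h1 := hcol ⟨e, he⟩
    have h2 : e = _ := hab ⟨e, he⟩
    rw [hc] at h1
    dsimp only at h1
    generalize a ⟨e, he⟩ = u at hn h1 h2
    generalize b ⟨e, he⟩ = v at hn h1 h2
    suffices hφ : (if 2 * σ u = s then s(-σ u, s + σ u) else s(σ u, s - σ u)) =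
        if 2 * σ v = s then s(-σ v, s + σ v) else s(σ v, s - σ v) by
      rw [h2] at hx hy
      rcases hx with rfl | rfl <;> rcases hy with rfl | rfl
      · rfl
      · exact hφ
      · exact hφ.symm
      · rfl
    rcases h1 with ⟨-, h1⟩ | ⟨h0, h1⟩
    · rw [if_neg fun h => hn (σ.injective (by linear_combination h - h1)),
        if_neg fun h => hn (σ.injective (by linear_combination h1 - h)), ← h1,
        add_sub_cancel_left, add_sub_cancel_right, Sym2.eq_swap]
    · rw [if_pos h1, if_neg fun h => hs (htwo _ (by linear_combination 2 * h0 - h1 - h)),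
        eq_neg_of_add_eq_zero_right h0, sub_neg_eq_add]
  · intro p hp
    obtain ⟨u, hu, rfl⟩ := mem_image.1 hp
    simp only [mem_filter, mem_univ, true_and] at hu
    have hxy : σ.symm u ≠ σ.symm (s - u) := by
      intro h
      exact hu (by linear_combination σ.symm.injective h)
    refine ⟨σ.symm u, fun hiso => ?_, by simp [hu]⟩
    have hmem : ({σ.symm u, σ.symm (s - u)} : Set (Fin (2 * m + 1))) ∈
        (completeUniform (2 * m + 1) 2).edgeSet := Set.ncard_pair hxy
    refine hiso _ ⟨hmem, congrArg τ ?_⟩ (Or.inl rfl)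
    have h1 := hcol ⟨_, hmem⟩
    have h2 : ({σ.symm u, σ.symm (s - u)} : Set (Fin (2 * m + 1))) = _ := hab ⟨_, hmem⟩
    have hsum : σ (a ⟨_, hmem⟩) + σ (b ⟨_, hmem⟩) = s := by
      rcases Set.pair_eq_pair_iff.1 h2 with ⟨h3, h4⟩ | ⟨h3, h4⟩
      · rw [← h3, ← h4]
        simp
      · rw [← h3, ← h4]
        simp
    rw [hsum] at h1
    rcases h1 with h1 | h1
    · exact Subtype.ext h1.2.symm
    · exact absurd h1.1 hs

/-! ### The five claims. -/

theorem two_mul_choose_two (n : ℕ) : 2 * n.choose 2 = n * (n - 1) := by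
  rw [Nat.choose_two_right, Nat.mul_div_cancel' (Nat.even_mul_pred_self n).two_dvd]

theorem theorem2 :
    (∀ n : ℕ, 2 ≤ n → f n (n - 1) 2 = n / 2) ∧
    (∀ n : ℕ, 3 ≤ n → f n n 2 = (n - 1) / 2) ∧
    (∀ n k : ℕ, 2 ≤ n → n - 1 ≤ k → k ∣ n.choose 2 →
      (f n k 2 : ℚ) = ((n : ℚ) * ((n : ℚ) - 1)) / (2 * (k : ℚ))) ∧
    (∀ n r t k : ℕ, 1 ≤ n → 1 ≤ r → 1 ≤ t → r * t ∣ n → k = t * (n - 1).choose (r - 1) →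
      (f n k r : ℚ) = (n : ℚ) / ((r : ℚ) * (t : ℚ))) ∧
    (∀ n r k : ℕ, 1 ≤ r → r ≤ n → n.choose r - (n - r).choose r ≤ k → k ≤ n.choose r →
      f n k r = n.choose r / k) := by
  refine ⟨?_, ?_, ?_, ?_, ?_⟩
  · intro n hn
    have hdiv : n.choose 2 / (n - 1) = n / 2 := by
      rw [Nat.choose_two_right, Nat.div_div_eq_div_mul, Nat.mul_div_mul_right _ _ (by omega)]
    rcases Nat.even_or_odd' n with ⟨m, rfl | rfl⟩
    · rw [f_eq_choose_div one_le_two (by omega) ?_, hdiv]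
      have := two_mul_choose_two (2 * m)
      rw [Nat.mul_div_cancel_left m two_pos]
      refine le_of_eq (Nat.eq_of_mul_eq_mul_left two_pos ?_)
      rw [this]
      ring
    · refine ((f_le 2 (by omega)).trans hdiv.le).antisymm ?_
      rw [show (2 * m + 1) / 2 = m by omega]
      exact le_f_two_mul_add_one (by omega)
  · intro n hn
    have hdiv : n.choose 2 / n = (n - 1) / 2 := by
      rw [Nat.choose_two_right, Nat.div_div_eq_div_mul, mul_comm 2,
        Nat.mul_div_mul_left _ _ (by omega)]
    rw [f_eq_choose_div one_le_two (by omega) ?_, hdiv]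
    have h1 := two_mul_choose_two n
    have h2 : n * (n - 1) ≤ n * (2 * (n / 2)) := Nat.mul_le_mul_left n (by omega)
    have h3 : n * (2 * (n / 2)) = 2 * (n * (n / 2)) := by ring
    omega
  · rintro n k hn hk ⟨d, hd⟩
    have hk0 : 0 < k := by omega
    have h1 := two_mul_choose_two n
    have h2 : k * (2 * d) ≤ k * n := by
      calc k * (2 * d) = n * (n - 1) := by rw [← h1, hd]; ring
        _ ≤ n * k := Nat.mul_le_mul_left n hk
        _ = k * n := mul_comm _ _
    have h3 : 2 * d ≤ n := Nat.le_of_mul_le_mul_left h2 hk0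
    rw [f_eq_choose_div one_le_two hk0
      (by rw [hd]; exact Nat.mul_le_mul_left k (by omega)), hd, Nat.mul_div_cancel_left d hk0]
    rw [hd] at h1
    have h4 : (2 * (k * d) : ℚ) = n * ((n : ℚ) - 1) := by
      rw [← Nat.cast_pred (by omega : 0 < n)]
      exact_mod_cast h1
    rw [← h4]
    field_simp
  · rintro n r t k hn hr ht ⟨q, rfl⟩ hk
    have hq : 0 < q := Nat.pos_of_mul_pos_left hn
    have hrn : r ≤ r * t * q := by
      rw [mul_assoc]
      exact Nat.le_mul_of_pos_right r (Nat.mul_pos ht hq)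
    have hk0 : 0 < k := by
      rw [hk]
      exact Nat.mul_pos ht (Nat.choose_pos (by omega))
    have h1 : (r * t * q).choose r = k * q := by
      refine Nat.eq_of_mul_eq_mul_right hr ?_
      -- Absorption: n·C(n-1,r-1) = C(n,r)·r.
      have h := Nat.add_one_mul_choose_eq (r * t * q - 1) (r - 1)
      rw [Nat.sub_add_cancel hn, Nat.sub_add_cancel hr] at h
      rw [← h, hk]
      ring
    have h2 : r * t * q / r = t * q := by
      rw [mul_assoc, Nat.mul_div_cancel_left _ hr]
    rw [f_eq_choose_div hr hk0
      (by rw [h1, h2]; exact Nat.mul_le_mul_left k (Nat.le_mul_of_pos_left q ht)), h1,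
      Nat.mul_div_cancel_left q hk0]
    push_cast
    field_simp
  · intro n r k hr hrn hk _
    have hpos : 0 < n.choose r := Nat.choose_pos hrn
    have h := choose_le_div_mul_sub (n := n) hr
    have h' : n.choose r ≤ k * (n / r) := by
      rw [mul_comm]
      exact h.trans (Nat.mul_le_mul_left _ hk)
    exact f_eq_choose_div hr (Nat.pos_of_mul_pos_right (hpos.trans_le h')) h'
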